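/- Let $\mathcal U\subset\mathbb R^N$ be open and let $f:\mathcal U\to\mathbb R^N$ be smooth. Assume that the system $\partial_t u+\partial_x f(u)=0$ is strictly hyperbolic: for every $u\in\mathcal U$ the matrix $\nabla f(u)$ has $N$ real eigenvalues $\lambda_1(u)<\dots<\lambda_N(u)$, with eigenvectors $r_1(u),\dots,r_N(u)$. Fix $u_B\in\mathcal U$ and a Lax-Friedrichs type scheme, that is, the numerical flux $$g(v,w)=\tfrac12\bigl(f(v)+f(w)\bigr)-\tfrac{Q}{\lambda}(w-v),\qquad 0<Q<1,\quad \lambda>0,$$ where $\lambda$ is small enough that $\lambda\,|\lambda_j(u_B)|<2Q$ for all $j$. For an open set $V\subset\mathcal U$ containing $u_B$, let $\mathcal E_V(u_B)$ be the discrete boundary-layer set for the state space $V$: the set of all $v_\infty\in V$ for which there is a sequence $(v_n)_{n\ge 0}$ in $V$ (the values of a piecewise constant profile on the cells $[n,n+1)$) with $$v_0=u_B,\qquad g(v_n,v_{n+1})=f(v_\infty)\ \text{ for all } n\ge 0,\qquad \lim_{n\to\infty}v_n=v_\infty ;$$ thus $\mathcal E_{\mathcal U}(u_B)=\mathcal E^{\text{layer}}_{\text{Lax}}(u_B)$.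 Assume that for some $p\in\{0,\dots,N\}$ and for all $u$ in a neighborhood of $u_B$ $$\lambda_p(u)<0\le\lambda_{p+1}(u)$$ (for $p=0$ or $p=N$ the inequality that involves $\lambda_0$ or $\lambda_{N+1}$ is omitted). Then: 1. $u_B\in\mathcal E^{\text{layer}}_{\text{Lax}}(u_B)$. 2. For every open $V\subset\mathcal U$ containing $u_B$, however small, the set $\mathcal E_V(u_B)$, and hence $\mathcal E^{\text{layer}}_{\text{Lax}}(u_B)$, contains a $p$-dimensional embedded $C^1$ submanifold of $\mathbb R^N$ that passes through $u_B$. 3. If moreover $0<\lambda_{p+1}(u_B)$ (no further condition if $p=N$), the boundary-layer set is a manifold of dimension exactly $p$ when the state space is a small neighborhood of $u_B$: there is an open neighborhood $V_0\subset\mathcal U$ of $u_B$ such that for every open $V\subset V_0$ containing $u_B$ the set $\mathcal E_V(u_B)$ is a $p$-dimensional embedded $C^1$ submanifold of $\mathbb R^N$, whose tangent space at $u_B$ is spanned by $r_1(u_B),\dots,r_p(u_B)$. -/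

import Mathlib

open Filter Topology
open scoped ContDiff

/-- `lam j u` (increasing and distinct in `j`) are the `N` real eigenvalues of the Jacobian of `f`
at every state `u` of `U`, and `r j u` are corresponding (right) eigenvectors: the system
`∂ₜ u + ∂ₓ f(u) = 0` is strictly hyperbolic on `U` with wave speeds `lam` and eigenvectors `r`. -/
structure StrictlyHyperbolicOn {N : ℕ}
    (f : EuclideanSpace ℝ (Fin N) → EuclideanSpace ℝ (Fin N))
    (U : Set (EuclideanSpace ℝ (Fin N)))
    (lam : Fin N → EuclideanSpace ℝ (Fin N) → ℝ)
    (r : Fin N → EuclideanSpace ℝ (Fin N) → EuclideanSpace ℝ (Fin N)) : Prop where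
  strictMono : ∀ u ∈ U, StrictMono fun j => lam j u
  eigenvector_ne_zero : ∀ u ∈ U, ∀ j, r j u ≠ 0
  eigenvector : ∀ u ∈ U, ∀ j, fderiv ℝ f u (r j u) = lam j u • r j u

/-- The numerical flux `(f(v) + f(w)) / 2 - (Q / l) (w - v)` of the Lax-Friedrichs type scheme with
mesh ratio `l` (time step over space step) and numerical coefficient `Q`. -/
noncomputable def laxFriedrichsFlux {N : ℕ} (l Q : ℝ)
    (f : EuclideanSpace ℝ (Fin N) → EuclideanSpace ℝ (Fin N))
    (v w : EuclideanSpace ℝ (Fin N)) : EuclideanSpace ℝ (Fin N) :=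
  (1 / 2 : ℝ) • (f v + f w) - (Q / l) • (w - v)

/-- The discrete boundary-layer set of the scheme with numerical flux `g`, for the state space `V`
and the boundary state `uB`: all `vinf` in `V` that are the limit of a boundary-layer profile.
The profile is constant on each cell `[n, n + 1)`, so it is given by the sequence `v` of
its values on the cells, with value `uB` on the first one. -/
def discreteLayerSet {N : ℕ}
    (g : EuclideanSpace ℝ (Fin N) → EuclideanSpace ℝ (Fin N) → EuclideanSpace ℝ (Fin N))
    (f : EuclideanSpace ℝ (Fin N) → EuclideanSpace ℝ (Fin N))
    (V : Set (EuclideanSpace ℝ (Fin N))) (uB : EuclideanSpace ℝ (Fin N)) :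
    Set (EuclideanSpace ℝ (Fin N)) :=
  {vinf | vinf ∈ V ∧ ∃ v : ℕ → EuclideanSpace ℝ (Fin N),
    (∀ n, v n ∈ V) ∧ v 0 = uB ∧ (∀ n, g (v n) (v (n + 1)) = f vinf) ∧
      Tendsto v atTop (𝓝 vinf)}

/-- `M` is an embedded `C¹` submanifold of `ℝᴺ` of dimension `p`: near each of its points it is the
zero set of a `C¹` submersion into `ℝ^q`, where `p + q = N`. -/
def IsC1Submanifold {N : ℕ} (p : ℕ) (M : Set (EuclideanSpace ℝ (Fin N))) : Prop :=
  ∀ x ∈ M, ∃ (q : ℕ) (O : Set (EuclideanSpace ℝ (Fin N)))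
    (Ψ : EuclideanSpace ℝ (Fin N) → EuclideanSpace ℝ (Fin q)),
    p + q = N ∧ IsOpen O ∧ x ∈ O ∧ ContDiffOn ℝ 1 Ψ O ∧
      (∀ y ∈ O, Function.Surjective (fderiv ℝ Ψ y)) ∧ M ∩ O = {y ∈ O | Ψ y = 0}

/-- The tangent space of `M` at `x`, as the set of velocities at `x` of curves in `M`
through `x`. -/
def tangentVectors {N : ℕ} (M : Set (EuclideanSpace ℝ (Fin N))) (x : EuclideanSpace ℝ (Fin N)) :
    Set (EuclideanSpace ℝ (Fin N)) :=
  {w | ∃ γ : ℝ → EuclideanSpace ℝ (Fin N),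
    γ 0 = x ∧ (∀ᶠ t in 𝓝 (0 : ℝ), γ t ∈ M) ∧ HasDerivAt γ w 0}

open scoped BoundedContinuousFunction
open BoundedContinuousFunction

/-! ### Differentiability of maps into bounded sequences -/

/-! Write a profile as `v n = z + h n` with limit `z = uB - h 0`, and put `a = l / (2 * Q)`. The
layer equation becomes a recursion for `h` whose linearization at 0 decouples in the eigenbasis:
coordinate `j` is multiplied at each step by `(1 + a λⱼ) / (1 - a λⱼ)`. The CFL condition makes this
positive, and it is below, equal to or above 1 as `λⱼ` is negative, zero or positive. So `p` modes
decay, and a local stable manifold of dimension `p` is expected.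

It is built by the Lyapunov–Perron method. Put `μ ^ n • h n` in place of `h n`, where `h` is now
bounded and `μ < 1` exceeds the decaying multipliers; a zero speed then counts as unstable. The
linearized equation together with the stable coordinates of `h 0` is a bijection
(`bijective_layerDerivWithData`), so the inverse function theorem (`exists_layer_profiles`) gives a
`C¹` family `S` parametrized by these coordinates. The limits `z` satisfy `S ξ 0 = uB - z`, with `ξ`
the stable coordinates of `uB - z`: this is a graph, cut out by `layerDefining`, and it yields the
submanifold for every `V`.

If no speed vanishes, the same argument works with `μ = 1`, that is, without assuming any decay
rate. Local injectivity there (`exists_layerIncrement_unique`) forces every layer staying near `uB`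
into the family, so the layer set is the manifold. A cutoff of `f` near `uB` makes all estimates
global. -/

theorem BoundedContinuousFunction.hasFDerivAt_of_pointwise
    {X E : Type*} [NormedAddCommGroup X] [NormedSpace ℝ X] [NormedAddCommGroup E] [NormedSpace ℝ E]
    {T : X → ℕ →ᵇ E} {D : X → X →L[ℝ] (ℕ →ᵇ E)} (hD : Continuous D)
    (hT : ∀ x n, HasFDerivAt (fun y => T y n) ((evalCLM ℝ n).comp (D x)) x) (x : X) :
    HasFDerivAt T (D x) x := by
  rw [hasFDerivAt_iff_isLittleO, Asymptotics.isLittleO_iff]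
  intro c hc
  obtain ⟨δ, hδ, hball⟩ := Metric.continuousAt_iff.1 hD.continuousAt c hc
  filter_upwards [Metric.ball_mem_nhds x hδ] with y hy
  refine (BoundedContinuousFunction.norm_le (by positivity)).2 fun n => ?_
  -- Operator-norm continuity of `D` gives one radius `δ` for all `n`, so the mean value inequality
  -- is uniform over the components.
  have key := (convex_ball x δ).norm_image_sub_le_of_norm_hasFDerivWithin_le'
    (f := fun y => T y n) (f' := fun y => (evalCLM ℝ n).comp (D y))
    (φ := (evalCLM ℝ n).comp (D x)) (C := c)
    (fun w _ => (hT w n).hasFDerivWithinAt) (fun w hw => ?_) (Metric.mem_ball_self hδ) hy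
  · simpa using key
  · refine ContinuousLinearMap.opNorm_le_bound _ hc.le fun k => ?_
    have h1 : ‖(D w - D x) k n‖ ≤ ‖(D w - D x) k‖ := norm_coe_le_norm _ n
    have h2 : ‖(D w - D x) k‖ ≤ ‖D w - D x‖ * ‖k‖ := ContinuousLinearMap.le_opNorm _ _
    have h3 : ‖D w - D x‖ ≤ c := by
      have := hball hw
      rw [dist_eq_norm] at this
      exact this.le
    calc _ = ‖(D w - D x) k n‖ := by simp
      _ ≤ ‖D w - D x‖ * ‖k‖ := h1.trans h2
      _ ≤ c * ‖k‖ := by gcongr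

theorem BoundedContinuousFunction.contDiff_one_of_pointwise
    {X E : Type*} [NormedAddCommGroup X] [NormedSpace ℝ X] [NormedAddCommGroup E] [NormedSpace ℝ E]
    {T : X → ℕ →ᵇ E} {D : X → X →L[ℝ] (ℕ →ᵇ E)} (hD : Continuous D)
    (hT : ∀ x n, HasFDerivAt (fun y => T y n) ((evalCLM ℝ n).comp (D x)) x) :
    ContDiff ℝ 1 T :=
  contDiff_one_iff_hasFDerivAt.2 ⟨D, hD, hasFDerivAt_of_pointwise hD hT⟩

/-! ### Rescaled increments -/

section Increment

variable {E F : Type*} [NormedAddCommGroup E] [NormedSpace ℝ E]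
  [NormedAddCommGroup F] [NormedSpace ℝ F]

/-- The difference quotient of `G` at `z` in the direction `h` with step `e`. -/
noncomputable def scaledIncrement (G : E → F) (e : ℝ) (z h : E) : F :=
  e⁻¹ • (G (z + e • h) - G z)

@[simp] theorem scaledIncrement_zero (G : E → F) (e : ℝ) (z : E) :
    scaledIncrement G e z 0 = 0 := by simp [scaledIncrement]

theorem smul_scaledIncrement (G : E → F) {e : ℝ} (he : e ≠ 0) (z h : E) :
    e • scaledIncrement G e z h = G (z + e • h) - G z := by
  simp [scaledIncrement, smul_smul, he]

theorem norm_scaledIncrement_sub_right_le {G : E → F} {K : NNReal} (hG : LipschitzWith K G)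
    {e : ℝ} (he : 0 < e) (z h h' : E) :
    ‖scaledIncrement G e z h - scaledIncrement G e z h'‖ ≤ K * ‖h - h'‖ := by
  have h1 : ‖G (z + e • h) - G (z + e • h')‖ ≤ K * (e * ‖h - h'‖) := by
    have := hG.norm_sub_le (z + e • h) (z + e • h')
    rwa [add_sub_add_left_eq_sub, ← smul_sub, norm_smul, Real.norm_of_nonneg he.le] at this
  have h2 : scaledIncrement G e z h - scaledIncrement G e z h' =
      e⁻¹ • (G (z + e • h) - G (z + e • h')) := by
    simp only [scaledIncrement, ← smul_sub]; congr 1; abel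
  rw [h2, norm_smul, Real.norm_of_nonneg (inv_nonneg.2 he.le)]
  calc _ ≤ e⁻¹ * (K * (e * ‖h - h'‖)) := by gcongr
    _ = K * ‖h - h'‖ := by field_simp

theorem norm_scaledIncrement_le {G : E → F} {K : NNReal} (hG : LipschitzWith K G)
    {e : ℝ} (he : 0 < e) (z h : E) : ‖scaledIncrement G e z h‖ ≤ K * ‖h‖ := by
  simpa using norm_scaledIncrement_sub_right_le hG he z h 0

/-- The derivative of `w ↦ G (w + e • h) - G w` is at most `K * e * ‖h‖`; the factor `e` cancels the
division, so the bound does not degenerate as `e → 0`. -/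
theorem norm_scaledIncrement_sub_left_le {G : E → F} {K : NNReal} (hG : Differentiable ℝ G)
    (hG' : LipschitzWith K (fderiv ℝ G)) {e : ℝ} (he : 0 < e) (z z' h : E) :
    ‖scaledIncrement G e z h - scaledIncrement G e z' h‖ ≤ K * ‖h‖ * ‖z - z'‖ := by
  have hd : ∀ w, HasFDerivAt (fun w => G (w + e • h) - G w)
      (fderiv ℝ G (w + e • h) - fderiv ℝ G w) w := fun w =>
    ((hasFDerivAt_comp_add_right (e • h)).2 (hG (w + e • h)).hasFDerivAt).sub (hG w).hasFDerivAt
  have h1 : ‖(G (z + e • h) - G z) - (G (z' + e • h) - G z')‖ ≤ (K * (e * ‖h‖)) * ‖z - z'‖ := by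
    refine convex_univ.norm_image_sub_le_of_norm_hasFDerivWithin_le
      (f := fun w => G (w + e • h) - G w)
      (fun w _ => (hd w).hasFDerivWithinAt) (fun w _ => ?_) (Set.mem_univ z') (Set.mem_univ z)
    have := hG'.norm_sub_le (w + e • h) w
    rwa [add_sub_cancel_left, norm_smul, Real.norm_of_nonneg he.le] at this
  simp only [scaledIncrement]
  rw [← smul_sub, norm_smul, Real.norm_of_nonneg (inv_nonneg.2 he.le)]
  calc _ ≤ e⁻¹ * ((K * (e * ‖h‖)) * ‖z - z'‖) := by gcongr
    _ = _ := by field_simp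

end Increment

/-! ### The superposition operator on weighted bounded sequences -/

section Superposition

variable {E : Type*} [NormedAddCommGroup E] [NormedSpace ℝ E]

/-- The increments of `f` from the limit state `uB - h 0` along the profile
`n ↦ uB - h 0 + μ ^ n • h n`, rescaled by `μ ^ n`. -/
noncomputable def profileIncrement (f : E → E) {K : NNReal} (hf : LipschitzWith K f) {μ : ℝ}
    (hμ : 0 < μ) (uB : E) (h : ℕ →ᵇ E) : ℕ →ᵇ E :=
  ofNormedAddCommGroupDiscrete (fun n => scaledIncrement f (μ ^ n) (uB - h 0) (h n)) (K * ‖h‖)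
    fun n => (norm_scaledIncrement_le hf (pow_pos hμ n) _ _).trans <| by
      gcongr; exact norm_coe_le_norm h n

/-- The derivative of `profileIncrement`. -/
noncomputable def profileIncrementDeriv (f : E → E) {K : NNReal} {L : NNReal}
    (hf : ∀ x, ‖fderiv ℝ f x‖ ≤ K) (hf' : LipschitzWith L (fderiv ℝ f)) {μ : ℝ}
    (hμ : 0 < μ) (uB : E) (h : ℕ →ᵇ E) : (ℕ →ᵇ E) →L[ℝ] (ℕ →ᵇ E) :=
  -- The second term appears because the base point `uB - h 0` moves with `h`. Its factor `(μ ^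
  -- n)⁻¹` is absorbed by the Lipschitz bound on `fderiv ℝ f`.
  have bound : ∀ (k : ℕ →ᵇ E) n, ‖fderiv ℝ f (uB - h 0 + μ ^ n • h n) (k n) -
      scaledIncrement (fderiv ℝ f) (μ ^ n) (uB - h 0) (h n) (k 0)‖ ≤ (K + L * ‖h‖) * ‖k‖ := by
    intro k n
    have h1 : ‖fderiv ℝ f (uB - h 0 + μ ^ n • h n) (k n)‖ ≤ K * ‖k‖ :=
      ContinuousLinearMap.le_of_opNorm_le_of_le _ (hf _) (norm_coe_le_norm k n)
    have h2 : ‖scaledIncrement (fderiv ℝ f) (μ ^ n) (uB - h 0) (h n) (k 0)‖ ≤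
        L * ‖h‖ * ‖k‖ := by
      refine ContinuousLinearMap.le_of_opNorm_le_of_le _ ?_ (norm_coe_le_norm k 0)
      refine (norm_scaledIncrement_le hf' (pow_pos hμ n) _ _).trans ?_
      gcongr; exact norm_coe_le_norm h n
    calc _ ≤ _ := norm_sub_le _ _
      _ ≤ K * ‖k‖ + L * ‖h‖ * ‖k‖ := add_le_add h1 h2
      _ = _ := by ring
  LinearMap.mkContinuous
    { toFun := fun k => ofNormedAddCommGroupDiscrete _ _ (bound k)
      map_add' := fun k k' => by ext n; simp; abel
      map_smul' := fun c k => by ext n; simp [smul_sub] }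
    (K + L * ‖h‖)
    fun k => (BoundedContinuousFunction.norm_le (by positivity)).2 (bound k)

@[simp] theorem profileIncrementDeriv_apply (f : E → E) {K : NNReal} {L : NNReal}
    (hf : ∀ x, ‖fderiv ℝ f x‖ ≤ K) (hf' : LipschitzWith L (fderiv ℝ f)) {μ : ℝ}
    (hμ : 0 < μ) (uB : E) (h k : ℕ →ᵇ E) (n : ℕ) :
    profileIncrementDeriv f hf hf' hμ uB h k n = fderiv ℝ f (uB - h 0 + μ ^ n • h n) (k n) -
      scaledIncrement (fderiv ℝ f) (μ ^ n) (uB - h 0) (h n) (k 0) := rfl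

/-- All estimates are independent of `n`. The Lipschitz bound on the second derivative is needed to
compare rescaled increments of `fderiv ℝ f` at different base points. -/
theorem continuous_profileIncrementDeriv (f : E → E) {K : NNReal} {L L' : NNReal}
    (hf : ∀ x, ‖fderiv ℝ f x‖ ≤ K) (hf' : LipschitzWith L (fderiv ℝ f))
    (hd : Differentiable ℝ (fderiv ℝ f)) (hf'' : LipschitzWith L' (fderiv ℝ (fderiv ℝ f))) {μ : ℝ}
    (hμ : 0 < μ) (hμ1 : μ ≤ 1) (uB : E) :
    Continuous (profileIncrementDeriv f hf hf' hμ uB) := by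
  rw [continuous_iff_continuousAt]
  intro h'
  have bound : ∀ h, ‖profileIncrementDeriv f hf hf' hμ uB h -
      profileIncrementDeriv f hf hf' hμ uB h'‖ ≤ (L * 3 + L' * ‖h'‖) * ‖h - h'‖ := by
    intro h
    refine ContinuousLinearMap.opNorm_le_bound _ (by positivity) fun k => ?_
    refine (BoundedContinuousFunction.norm_le (by positivity)).2 fun n => ?_
    have e0 : 0 < μ ^ n := pow_pos hμ n
    have e1 : μ ^ n ≤ 1 := pow_le_one₀ hμ.le hμ1
    have hn : ‖h n - h' n‖ ≤ ‖h - h'‖ := norm_coe_le_norm (h - h') n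
    have h0 : ‖h 0 - h' 0‖ ≤ ‖h - h'‖ := norm_coe_le_norm (h - h') 0
    have hz : ‖(uB - h 0) - (uB - h' 0)‖ ≤ ‖h - h'‖ := by
      rwa [sub_sub_sub_cancel_left, norm_sub_rev]
    have hh' : ‖h' n‖ ≤ ‖h'‖ := norm_coe_le_norm h' n
    have a1 : ‖fderiv ℝ f (uB - h 0 + μ ^ n • h n) - fderiv ℝ f (uB - h' 0 + μ ^ n • h' n)‖ ≤
        L * (2 * ‖h - h'‖) := by
      refine (hf'.norm_sub_le _ _).trans ?_
      gcongr
      have : uB - h 0 + μ ^ n • h n - (uB - h' 0 + μ ^ n • h' n) =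
          ((uB - h 0) - (uB - h' 0)) + μ ^ n • (h n - h' n) := by
        rw [smul_sub]; abel
      rw [this]
      refine (norm_add_le _ _).trans ?_
      rw [norm_smul, Real.norm_of_nonneg e0.le]
      have : μ ^ n * ‖h n - h' n‖ ≤ 1 * ‖h - h'‖ := by gcongr
      linarith
    have a2 : ‖scaledIncrement (fderiv ℝ f) (μ ^ n) (uB - h 0) (h n) -
        scaledIncrement (fderiv ℝ f) (μ ^ n) (uB - h' 0) (h' n)‖ ≤
        L * ‖h - h'‖ + L' * ‖h'‖ * ‖h - h'‖ := by
      refine (norm_sub_le_norm_sub_add_norm_sub _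
        (scaledIncrement (fderiv ℝ f) (μ ^ n) (uB - h 0) (h' n)) _).trans (add_le_add ?_ ?_)
      · exact (norm_scaledIncrement_sub_right_le hf' e0 _ _ _).trans (by gcongr)
      · exact (norm_scaledIncrement_sub_left_le hd hf'' e0 _ _ _).trans (by gcongr)
    have b1 := ContinuousLinearMap.le_of_opNorm_le_of_le _ a1 (norm_coe_le_norm k n)
    have b2 := ContinuousLinearMap.le_of_opNorm_le_of_le _ a2 (norm_coe_le_norm k 0)
    have e : (profileIncrementDeriv f hf hf' hμ uB h -
        profileIncrementDeriv f hf hf' hμ uB h') k n =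
      (fderiv ℝ f (uB - h 0 + μ ^ n • h n) - fderiv ℝ f (uB - h' 0 + μ ^ n • h' n)) (k n) -
      (scaledIncrement (fderiv ℝ f) (μ ^ n) (uB - h 0) (h n) -
        scaledIncrement (fderiv ℝ f) (μ ^ n) (uB - h' 0) (h' n)) (k 0) := by
      simp; abel
    rw [e]
    refine (norm_sub_le _ _).trans ((add_le_add b1 b2).trans_eq ?_)
    ring
  rw [ContinuousAt, tendsto_iff_norm_sub_tendsto_zero]
  refine squeeze_zero (fun _ => norm_nonneg _) bound ?_
  have : Tendsto (fun h => (L * 3 + L' * ‖h'‖) * ‖h - h'‖) (𝓝 h')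
      (𝓝 ((L * 3 + L' * ‖h'‖) * ‖h' - h'‖)) := by
    apply Continuous.tendsto; fun_prop
  simpa using this

theorem hasFDerivAt_profileIncrement_apply (f : E → E) {K : NNReal} {L : NNReal}
    (hlip : LipschitzWith K f) (hdf : Differentiable ℝ f)
    (hf : ∀ x, ‖fderiv ℝ f x‖ ≤ K) (hf' : LipschitzWith L (fderiv ℝ f)) {μ : ℝ}
    (hμ : 0 < μ) (uB : E) (h : ℕ →ᵇ E) (n : ℕ) :
    HasFDerivAt (fun h => profileIncrement f hlip hμ uB h n)
      ((evalCLM ℝ n).comp (profileIncrementDeriv f hf hf' hμ uB h)) h := by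
  have ev : ∀ m, HasFDerivAt (fun h : ℕ →ᵇ E => h m) (evalCLM ℝ m : (ℕ →ᵇ E) →L[ℝ] E) h :=
    fun m => (evalCLM ℝ m : (ℕ →ᵇ E) →L[ℝ] E).hasFDerivAt
  have hz := (ev 0).const_sub uB
  have hv := hz.add ((ev n).const_smul (μ ^ n))
  have h1 := (hdf (uB - h 0 + μ ^ n • h n)).hasFDerivAt.comp h hv
  have h2 := (hdf (uB - h 0)).hasFDerivAt.comp h hz
  have h3 := (h1.sub h2).const_smul (μ ^ n)⁻¹
  refine h3.congr_fderiv ?_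
  ext k
  have : (μ ^ n) ≠ 0 := (pow_pos hμ n).ne'
  simp [scaledIncrement, smul_sub, smul_smul, this]
  abel

end Superposition

/-! ### Scalar recursions with bounded solutions -/

/-- Stable modes: a contraction run forward stays bounded for any initial value. -/
theorem exists_bounded_forward_recursion {ρ C : ℝ} (h0 : 0 ≤ ρ) (h1 : ρ < 1) (y : ℕ → ℝ)
    (hy : ∀ n, |y n| ≤ C) (x : ℝ) :
    ∃ k : ℕ → ℝ, (∃ B, ∀ n, |k n| ≤ B) ∧ k 0 = x ∧ ∀ n, k (n + 1) = ρ * k n + y n := by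
  have hC : 0 ≤ C := (abs_nonneg _).trans (hy 0)
  have hr : 0 < 1 - ρ := by linarith
  refine ⟨fun n => Nat.rec x (fun n k => ρ * k + y n) n, ⟨|x| + C / (1 - ρ), fun n => ?_⟩, rfl,
    fun n => rfl⟩
  induction n with
  | zero => simpa using div_nonneg hC hr.le
  | succ n ih =>
    refine (abs_add_le _ _).trans ?_
    rw [abs_mul, abs_of_nonneg h0]
    have e : C = (1 - ρ) * (C / (1 - ρ)) := by field_simp
    have h2 := mul_le_mul_of_nonneg_left ih h0
    have h3 := hy n
    have h4 : ρ * |x| ≤ 1 * |x| := by gcongr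
    nlinarith

/-- Unstable modes are summed from infinity, `k n = ∑ ρ ^ m * y (n + m)`, with no initial value to
choose. -/
theorem exists_bounded_backward_recursion {ρ C : ℝ} (h0 : 0 ≤ ρ) (h1 : ρ < 1) (y : ℕ → ℝ)
    (hy : ∀ n, |y n| ≤ C) :
    ∃ k : ℕ → ℝ, (∃ B, ∀ n, |k n| ≤ B) ∧ ∀ n, k n = ρ * k (n + 1) + y n := by
  have bd : ∀ n m, ‖ρ ^ m * y (n + m)‖ ≤ ρ ^ m * C := fun n m => by
    rw [Real.norm_eq_abs, abs_mul, abs_of_nonneg (pow_nonneg h0 m)]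
    have := hy (n + m)
    gcongr
  have hs : Summable fun m => ρ ^ m * C := (summable_geometric_of_lt_one h0 h1).mul_right C
  have hsum : ∀ n, Summable fun m => ρ ^ m * y (n + m) := fun n => hs.of_norm_bounded (bd n)
  refine ⟨fun n => ∑' m, ρ ^ m * y (n + m), ⟨∑' m, ρ ^ m * C, fun n => ?_⟩, fun n => ?_⟩
  · exact tsum_of_norm_bounded hs.hasSum (bd n)
  · dsimp only
    rw [(hsum n).tsum_eq_zero_add, ← tsum_mul_left, add_comm]
    congr 1
    · refine tsum_congr fun m => ?_
      rw [pow_succ', mul_assoc, show n + (m + 1) = n + 1 + m by ring]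
    · simp

theorem eq_zero_of_bounded_backward_recursion {ρ B : ℝ} (h0 : 0 ≤ ρ) (h1 : ρ < 1) (k : ℕ → ℝ)
    (hB : ∀ n, |k n| ≤ B) (hk : ∀ n, k n = ρ * k (n + 1)) (n : ℕ) : k n = 0 := by
  have it : ∀ m, k n = ρ ^ m * k (n + m) := by
    intro m
    induction m with
    | zero => simp
    | succ m ih => rw [ih, hk (n + m)]; ring_nf
  have hb : ∀ m, |k n| ≤ ρ ^ m * B := fun m => by
    rw [it m, abs_mul, abs_of_nonneg (pow_nonneg h0 m)]
    have := hB (n + m)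
    gcongr
  have ht : Tendsto (fun m => ρ ^ m * B) atTop (𝓝 (0 * B)) :=
    (tendsto_pow_atTop_nhds_zero_of_lt_one h0 h1).mul_const B
  have := ge_of_tendsto' ht hb
  simpa using this

/-! ### The layer operator -/

section LayerOperator

variable {E : Type*} [NormedAddCommGroup E] [NormedSpace ℝ E]

/-- The shift on bounded sequences. -/
noncomputable def seqShift (E : Type*) [NormedAddCommGroup E] [NormedSpace ℝ E] :
    (ℕ →ᵇ E) →L[ℝ] (ℕ →ᵇ E) :=
  compContinuousCLM E ℝ ⟨Nat.succ, continuous_of_discreteTopology⟩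

@[simp] theorem seqShift_apply (h : ℕ →ᵇ E) (n : ℕ) : seqShift E h n = h (n + 1) := rfl

/-- The operator whose zeros are the rescaled layer profiles with rate `μ`. -/
noncomputable def layerOp (a : ℝ) (f : E → E) {K : NNReal} (hf : LipschitzWith K f) {μ : ℝ}
    (hμ : 0 < μ) (uB : E) (h : ℕ →ᵇ E) : ℕ →ᵇ E :=
  (μ • seqShift E - 1) h - (a • (μ • seqShift E + 1)) (profileIncrement f hf hμ uB h)

theorem layerOp_apply (a : ℝ) (f : E → E) {K : NNReal} (hf : LipschitzWith K f) {μ : ℝ}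
    (hμ : 0 < μ) (uB : E) (h : ℕ →ᵇ E) (n : ℕ) :
    layerOp a f hf hμ uB h n = μ • h (n + 1) - h n -
      a • (μ • scaledIncrement f (μ ^ (n + 1)) (uB - h 0) (h (n + 1)) +
        scaledIncrement f (μ ^ n) (uB - h 0) (h n)) := rfl

theorem layerOp_zero (a : ℝ) (f : E → E) {K : NNReal} (hf : LipschitzWith K f) {μ : ℝ}
    (hμ : 0 < μ) (uB : E) : layerOp a f hf hμ uB 0 = 0 := by
  ext n
  simp [layerOp_apply]

theorem layerOp_eq_zero_iff (a : ℝ) (f : E → E) {K : NNReal} (hf : LipschitzWith K f) {μ : ℝ}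
    (hμ : 0 < μ) (uB : E) (h : ℕ →ᵇ E) :
    layerOp a f hf hμ uB h = 0 ↔ ∀ n, μ ^ (n + 1) • h (n + 1) - μ ^ n • h n =
      a • ((f (uB - h 0 + μ ^ (n + 1) • h (n + 1)) - f (uB - h 0)) +
        (f (uB - h 0 + μ ^ n • h n) - f (uB - h 0))) := by
  rw [BoundedContinuousFunction.ext_iff]
  refine forall_congr' fun n => ?_
  have e0 : μ ^ n ≠ 0 := (pow_pos hμ n).ne'
  have e1 : μ ^ (n + 1) ≠ 0 := (pow_pos hμ _).ne'
  rw [layerOp_apply, BoundedContinuousFunction.coe_zero, Pi.zero_apply,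
    ← smul_right_injective E e0 |>.eq_iff, smul_zero, ← sub_eq_zero (a := _ - _),
    ← smul_scaledIncrement f e0, ← smul_scaledIncrement f e1]
  apply Eq.congr_left
  module

/-- The linearization of the layer operator at the constant profile. -/
noncomputable def layerDeriv (a μ : ℝ) (A : E →L[ℝ] E) : (ℕ →ᵇ E) →L[ℝ] (ℕ →ᵇ E) :=
  (μ • seqShift E - 1) - (a • (μ • seqShift E + 1)).comp (A.compLeftContinuousBounded ℕ)

theorem layerDeriv_apply (a μ : ℝ) (A : E →L[ℝ] E) (k : ℕ →ᵇ E) (n : ℕ) :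
    layerDeriv a μ A k n = μ • k (n + 1) - k n - a • (μ • A (k (n + 1)) + A (k n)) := rfl

/-- Compact support turns smoothness into the global Lipschitz bounds required. At `h = 0` the
increments of `fderiv ℝ f` vanish, leaving a recursion with constant coefficients. -/
theorem contDiff_layerOp {f : E → E} (hf : ContDiff ℝ 3 f) (hc : HasCompactSupport f) (a : ℝ) {K : NNReal} (hlip : LipschitzWith K f) {μ : ℝ}
    (hμ : 0 < μ) (hμ1 : μ ≤ 1) (uB : E) :
    ContDiff ℝ 1 (layerOp a f hlip hμ uB) ∧
      HasFDerivAt (layerOp a f hlip hμ uB) (layerDeriv a μ (fderiv ℝ f uB)) 0 := by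
  have hf1 : ContDiff ℝ 2 (fderiv ℝ f) := hf.fderiv_right (by norm_num)
  have hf2 : ContDiff ℝ 1 (fderiv ℝ (fderiv ℝ f)) := hf1.fderiv_right (by norm_num)
  obtain ⟨L, hL⟩ := ContDiff.lipschitzWith_of_hasCompactSupport (hc.fderiv ℝ) hf1 (by simp)
  obtain ⟨L', hL'⟩ := ContDiff.lipschitzWith_of_hasCompactSupport ((hc.fderiv ℝ).fderiv ℝ) hf2 (by simp)
  have hK : ∀ x, ‖fderiv ℝ f x‖ ≤ K := fun x => norm_fderiv_le_of_lipschitz ℝ hlip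
  have hcont := continuous_profileIncrementDeriv f hK hL (hf1.differentiable (by simp)) hL' hμ hμ1
    uB
  have hpt := hasFDerivAt_profileIncrement_apply f hlip (hf.differentiable (by simp)) hK hL hμ uB
  have hN := contDiff_one_of_pointwise hcont hpt
  have hN0 := hasFDerivAt_of_pointwise hcont hpt 0
  refine ⟨(ContinuousLinearMap.contDiff _).sub ((ContinuousLinearMap.contDiff _).comp hN), ?_⟩
  have h1 := ((μ • seqShift E - 1 : (ℕ →ᵇ E) →L[ℝ] (ℕ →ᵇ E)).hasFDerivAt (x := 0)).sub
    ((a • (μ • seqShift E + 1) : (ℕ →ᵇ E) →L[ℝ] (ℕ →ᵇ E)).hasFDerivAt.comp 0 hN0)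
  refine h1.congr_fderiv ?_
  ext k n
  simp [layerDeriv_apply]

end LayerOperator

/-! ### Invertibility of the linearization -/

section Linearization

variable {E : Type*} [NormedAddCommGroup E] [NormedSpace ℝ E] {ι : Type*}

theorem repr_eigenbasis {A : E →L[ℝ] E} {b : Module.Basis ι ℝ E} {lam : ι → ℝ}
    (hA : ∀ j, A (b j) = lam j • b j) (x : E) (j : ι) :
    b.repr (A x) j = lam j * b.repr x j := by
  have h : (b.coord j).comp (A : E →ₗ[ℝ] E) = lam j • b.coord j := b.ext fun i => by
    by_cases hij : i = j <;> simp [hA, hij]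
  exact LinearMap.congr_fun h x

theorem repr_layerDeriv {a μ : ℝ} {A : E →L[ℝ] E} {b : Module.Basis ι ℝ E} {lam : ι → ℝ}
    (hA : ∀ j, A (b j) = lam j • b j) (k : ℕ →ᵇ E) (n : ℕ) (j : ι) :
    b.repr (layerDeriv a μ A k n) j =
      μ * (1 - a * lam j) * b.repr (k (n + 1)) j - (1 + a * lam j) * b.repr (k n) j := by
  rw [layerDeriv_apply]
  simp [repr_eigenbasis hA]
  ring

variable [FiniteDimensional ℝ E]

/-- The coordinates in the basis `b` whose index satisfies `st`. -/
noncomputable def stableCoords (b : Module.Basis ι ℝ E) (st : ι → Prop) :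
    E →L[ℝ] ({j // st j} → ℝ) :=
  ContinuousLinearMap.pi fun j => LinearMap.toContinuousLinearMap (b.coord j)

@[simp] theorem stableCoords_apply (b : Module.Basis ι ℝ E) (st : ι → Prop) (x : E)
    (j : {j // st j}) : stableCoords b st x j = b.repr x j := rfl

/-- The linearization of the layer operator, together with the stable coordinates of the
initial value. -/
noncomputable def layerDerivWithData (a μ : ℝ) (A : E →L[ℝ] E) (b : Module.Basis ι ℝ E)
    (st : ι → Prop) : (ℕ →ᵇ E) →L[ℝ] (ℕ →ᵇ E) × ({j // st j} → ℝ) :=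
  (layerDeriv a μ A).prod ((stableCoords b st).comp (evalCLM ℝ 0))

variable {a μ : ℝ} {A : E →L[ℝ] E} {b : Module.Basis ι ℝ E} {lam : ι → ℝ} {st : ι → Prop}

theorem exists_bound_repr (b : Module.Basis ι ℝ E) (k : ℕ →ᵇ E) (j : ι) :
    ∃ B, ∀ n, |b.repr (k n) j| ≤ B :=
  ⟨‖LinearMap.toContinuousLinearMap (b.coord j)‖ * ‖k‖, fun n =>
    (LinearMap.toContinuousLinearMap (b.coord j)).le_opNorm_of_le (norm_coe_le_norm k n)⟩

/-- The gap condition: `μ` separates the multipliers of the stable indices from the others. -/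
structure LayerGap (a μ : ℝ) (lam : ι → ℝ) (st : ι → Prop) : Prop where
  pos : 0 < μ
  le_one : μ ≤ 1
  num_pos : ∀ j, 0 < 1 + a * lam j
  den_pos : ∀ j, 0 < 1 - a * lam j
  stable : ∀ j, st j → 1 + a * lam j < μ * (1 - a * lam j)
  unstable : ∀ j, ¬ st j → μ * (1 - a * lam j) < 1 + a * lam j

theorem repr_eq_zero_of_layerDeriv_eq_zero (hA : ∀ j, A (b j) = lam j • b j)
    (hg : LayerGap a μ lam st) {k : ℕ →ᵇ E} (hk : layerDeriv a μ A k = 0) {j : ι} (hj : ¬ st j)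
    (n : ℕ) : b.repr (k n) j = 0 := by
  obtain ⟨B, hB⟩ := exists_bound_repr b k j
  have hp := hg.num_pos j
  refine eq_zero_of_bounded_backward_recursion (ρ := μ * (1 - a * lam j) / (1 + a * lam j))
    (div_nonneg (mul_nonneg hg.pos.le (hg.den_pos j).le) hp.le)
    ((div_lt_one hp).2 (hg.unstable j hj)) (fun n => b.repr (k n) j) hB (fun n => ?_) n
  have := repr_layerDeriv (a := a) (μ := μ) hA k n j
  rw [hk] at this
  simp only [coe_zero, Pi.zero_apply, map_zero, Finsupp.coe_zero] at this
  field_simp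
  linarith

/-- Each eigencoordinate is a scalar recursion. Stable ones run forward and need their initial
value; unstable ones have exactly one bounded solution. Hence the stable coordinates at `n = 0` are
precisely the missing data. -/
theorem bijective_layerDerivWithData [Fintype ι] (hA : ∀ j, A (b j) = lam j • b j)
    (hg : LayerGap a μ lam st) : Function.Bijective (layerDerivWithData a μ A b st) := by
  classical
  constructor
  · refine (injective_iff_map_eq_zero _).2 fun k hk => ?_
    have h1 : layerDeriv a μ A k = 0 := congrArg Prod.fst hk
    have h2 : stableCoords b st (k 0) = 0 := congrArg Prod.snd hk
    ext n
    refine b.ext_elem fun j => ?_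
    simp only [coe_zero, Pi.zero_apply, map_zero, Finsupp.coe_zero]
    by_cases hj : st j
    · induction n with
      | zero => exact congrFun h2 ⟨j, hj⟩
      | succ n ih =>
        have := repr_layerDeriv (a := a) (μ := μ) hA k n j
        rw [h1, ih] at this
        simp only [coe_zero, Pi.zero_apply, map_zero, Finsupp.coe_zero, mul_zero, sub_zero] at this
        have hne : μ * (1 - a * lam j) ≠ 0 := (mul_pos hg.pos (hg.den_pos j)).ne'
        exact (mul_eq_zero.1 this.symm).resolve_left hne
    · exact repr_eq_zero_of_layerDeriv_eq_zero hA hg h1 hj n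
  · rintro ⟨y, x⟩
    have key : ∀ j, ∃ k : ℕ → ℝ, (∃ B, ∀ n, |k n| ≤ B) ∧ (∀ hj : st j, k 0 = x ⟨j, hj⟩) ∧
        ∀ n, μ * (1 - a * lam j) * k (n + 1) - (1 + a * lam j) * k n = b.repr (y n) j := by
      intro j
      obtain ⟨C, hC⟩ := exists_bound_repr b y j
      have hp := hg.num_pos j
      have hq := mul_pos hg.pos (hg.den_pos j)
      by_cases hj : st j
      · obtain ⟨k, hB, h0, hk⟩ := exists_bounded_forward_recursion
          (ρ := (1 + a * lam j) / (μ * (1 - a * lam j)))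
          (C := C / (μ * (1 - a * lam j)))
          (div_nonneg hp.le hq.le) ((div_lt_one hq).2 (hg.stable j hj))
          (fun n => b.repr (y n) j / (μ * (1 - a * lam j)))
          (fun n => by rw [abs_div, abs_of_pos hq]; have := hC n; gcongr) (x ⟨j, hj⟩)
        refine ⟨k, hB, fun _ => h0, fun n => ?_⟩
        rw [hk n]
        have h1 := hq.ne'
        generalize μ * (1 - a * lam j) = q at h1
        field_simp
        ring
      · obtain ⟨k, hB, hk⟩ := exists_bounded_backward_recursion
          (ρ := μ * (1 - a * lam j) / (1 + a * lam j))
          (C := C / (1 + a * lam j))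
          (div_nonneg hq.le hp.le) ((div_lt_one hp).2 (hg.unstable j hj))
          (fun n => - b.repr (y n) j / (1 + a * lam j))
          (fun n => by rw [abs_div, abs_of_pos hp, abs_neg]; have := hC n; gcongr)
        refine ⟨k, hB, fun h => absurd h hj, fun n => ?_⟩
        rw [hk n]
        have h1 := hp.ne'
        generalize 1 + a * lam j = q at h1
        field_simp
        ring
    choose k hB h0 hk using key
    choose B hB using hB
    have hbd : ∀ n, ‖∑ j, k j n • b j‖ ≤ ∑ j, B j * ‖b j‖ := fun n =>
      norm_sum_le_of_le _ fun j _ => by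
        rw [norm_smul]
        exact mul_le_mul_of_nonneg_right (hB j n) (norm_nonneg _)
    let κ : ℕ →ᵇ E := ofNormedAddCommGroupDiscrete (fun n => ∑ j, k j n • b j) _ hbd
    have hκ : ∀ n j, b.repr (κ n) j = k j n := fun n j => by
      change b.repr (∑ j, k j n • b j) j = k j n
      rw [b.repr_sum_self]
    refine ⟨κ, Prod.ext ?_ ?_⟩
    · change layerDeriv a μ A κ = y
      ext n
      refine b.ext_elem fun j => ?_
      rw [repr_layerDeriv hA, hκ, hκ, hk]
    · funext ⟨j, hj⟩
      change b.repr (κ 0) j = _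
      rw [hκ, h0 j hj]

end Linearization

/-! ### Small layer profiles -/

section LocalSolutions

variable {E : Type*} [NormedAddCommGroup E] [NormedSpace ℝ E] [FiniteDimensional ℝ E]
  {ι : Type*} [Fintype ι] {f : E → E} {uB : E}
  {a μ : ℝ} {b : Module.Basis ι ℝ E} {lam : ι → ℝ} {st : ι → Prop}
  [DecidablePred st]

/-- The inverse function theorem at 0 gives both parts: uniqueness is local injectivity, and `S` is
the local inverse on the slice where the layer operator vanishes. -/
theorem exists_layer_profiles (hf : ContDiff ℝ 3 f) (hc : HasCompactSupport f) {K : NNReal}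
    (hlip : LipschitzWith K f) (hA : ∀ j, fderiv ℝ f uB (b j) = lam j • b j)
    (hg : LayerGap a μ lam st) :
    (∃ δ > 0, ∀ h h' : ℕ →ᵇ E, ‖h‖ < δ → ‖h'‖ < δ → layerOp a f hlip hg.pos uB h = 0 →
      layerOp a f hlip hg.pos uB h' = 0 →
      stableCoords b st (h 0) = stableCoords b st (h' 0) → h = h') ∧
    ∃ S : ({j // st j} → ℝ) → ℕ →ᵇ E, S 0 = 0 ∧ ContDiffAt ℝ 1 S 0 ∧
      (∀ᶠ ξ in 𝓝 0, layerOp a f hlip hg.pos uB (S ξ) = 0 ∧ stableCoords b st (S ξ 0) = ξ) ∧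
      ∀ ξ j, ¬ st j → b.repr (fderiv ℝ S 0 ξ 0) j = 0 := by
  obtain ⟨hF, hF0⟩ := contDiff_layerOp hf hc a hlip hg.pos hg.le_one uB
  let P : (ℕ →ᵇ E) →L[ℝ] ({j // st j} → ℝ) := (stableCoords b st).comp (evalCLM ℝ 0)
  let G : (ℕ →ᵇ E) → (ℕ →ᵇ E) × ({j // st j} → ℝ) :=
    fun h => (layerOp a f hlip hg.pos uB h, P h)
  let G' : (ℕ →ᵇ E) ≃L[ℝ] (ℕ →ᵇ E) × ({j // st j} → ℝ) :=
    -- Completeness of the sequence space enters here: the inverse is bounded by the open mapping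
    -- theorem.
    ContinuousLinearEquiv.ofBijective (layerDerivWithData a μ (fderiv ℝ f uB) b st)
      (LinearMap.ker_eq_bot.2 (bijective_layerDerivWithData hA hg).1)
      (LinearMap.range_eq_top.2 (bijective_layerDerivWithData hA hg).2)
  have hG : ContDiffAt ℝ 1 G 0 := (hF.prodMk P.contDiff).contDiffAt
  have hG' : HasFDerivAt G (G' : (ℕ →ᵇ E) →L[ℝ] _) 0 :=
    (hF0.prodMk P.hasFDerivAt).congr_fderiv <| by ext1 k; rfl
  have hG0 : G 0 = 0 := Prod.ext (layerOp_zero ..) (map_zero P)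
  let Φ := hG.toOpenPartialHomeomorph G hG' one_ne_zero
  have hΦ : ∀ h, Φ h = G h := fun _ => rfl
  have h0s : (0 : ℕ →ᵇ E) ∈ Φ.source :=
    hG.mem_toOpenPartialHomeomorph_source hG' one_ne_zero
  have h0t : (0 : (ℕ →ᵇ E) × ({j // st j} → ℝ)) ∈ Φ.target := by
    have := hG.image_mem_toOpenPartialHomeomorph_target hG' one_ne_zero
    rwa [hG0] at this
  have hsymm : ContDiffAt ℝ 1 Φ.symm 0 := by
    have := hG.to_localInverse hG' one_ne_zero
    rwa [hG0] at this
  have hS : ContDiffAt ℝ 1 (fun ξ => Φ.symm (0, ξ)) 0 :=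
    ContDiffAt.comp (g := Φ.symm) (f := fun ξ : {j // st j} → ℝ => ((0 : ℕ →ᵇ E), ξ)) 0 hsymm
      (contDiffAt_const.prodMk contDiffAt_id)
  have hS0 : Φ.symm (0, 0) = 0 := by
    have := Φ.left_inv h0s
    rwa [hΦ, hG0] at this
  have hev : ∀ᶠ ξ in 𝓝 (0 : {j // st j} → ℝ), G (Φ.symm (0, ξ)) = (0, ξ) := by
    have hct : ContinuousAt (fun ξ : {j // st j} → ℝ => ((0 : ℕ →ᵇ E), ξ)) 0 := by fun_prop
    filter_upwards [hct.preimage_mem_nhds (Φ.open_target.mem_nhds h0t)] with ξ hξ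
    exact Φ.right_inv hξ
  refine ⟨?_, fun ξ => Φ.symm (0, ξ), hS0, hS, ?_, ?_⟩
  · obtain ⟨δ, hδ, hball⟩ := Metric.mem_nhds_iff.1 (Φ.open_source.mem_nhds h0s)
    refine ⟨δ, hδ, fun h h' hh hh' h1 h2 h3 => Φ.injOn (hball (by simpa using hh))
      (hball (by simpa using hh')) (Prod.ext (h1.trans h2.symm) h3)⟩
  · filter_upwards [hev] with ξ hξ
    exact ⟨congrArg Prod.fst hξ, congrArg Prod.snd hξ⟩
  · intro ξ j hj
    -- Differentiating `layerOp (S ξ) = 0` at 0 shows that `fderiv ℝ S 0 ξ` is a bounded solution of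
    -- the linearized equation, so it has no unstable coordinate.
    have hSd := (hS.differentiableAt one_ne_zero).hasFDerivAt
    have hF0' : HasFDerivAt (layerOp a f hlip hg.pos uB) (layerDeriv a μ (fderiv ℝ f uB))
        (Φ.symm (0, 0)) := by rw [hS0]; exact hF0
    have hcomp := HasFDerivAt.comp (0 : {j // st j} → ℝ) hF0' hSd
    have hz : HasFDerivAt (layerOp a f hlip hg.pos uB ∘ fun ξ => Φ.symm (0, ξ))
        (0 : ({j // st j} → ℝ) →L[ℝ] (ℕ →ᵇ E)) 0 :=
      (hasFDerivAt_const (0 : ℕ →ᵇ E) 0).congr_of_eventuallyEq <| by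
        filter_upwards [hev] with ξ hξ
        exact congrArg Prod.fst hξ
    have hk := congrArg (fun T => T ξ) (hcomp.unique hz)
    exact repr_eq_zero_of_layerDeriv_eq_zero hA hg hk hj 0

end LocalSolutions

/-! ### Layer profiles as sequences of increments -/

section LayerEquation

variable {E : Type*} [NormedAddCommGroup E] [NormedSpace ℝ E]

/-- The boundary-layer recursion for the differences `h` between a profile with first value `uB`
and its limit `uB - h 0`. -/
def IsLayerIncrement (a : ℝ) (f : E → E) (uB : E) (h : ℕ → E) : Prop :=
  ∀ n, h (n + 1) - h n = a • ((f (uB - h 0 + h (n + 1)) - f (uB - h 0)) +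
    (f (uB - h 0 + h n) - f (uB - h 0)))

theorem layerOp_eq_zero_iff_isLayerIncrement (a : ℝ) (f : E → E) {K : NNReal}
    (hf : LipschitzWith K f) {μ : ℝ} (hμ : 0 < μ) (uB : E) (h : ℕ →ᵇ E) :
    layerOp a f hf hμ uB h = 0 ↔ IsLayerIncrement a f uB fun n => μ ^ n • h n := by
  rw [layerOp_eq_zero_iff]
  simp [IsLayerIncrement]

variable [FiniteDimensional ℝ E] {ι : Type*} [Fintype ι]

/-- A `C¹` family `S` of rescaled exponentially decaying layer increments, parametrized by the
stable coordinates of the initial increment. -/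
structure IsLayerFamily (a : ℝ) (f : E → E) (uB : E) (b : Module.Basis ι ℝ E) (st : ι → Prop)
    [DecidablePred st] (μ ε : ℝ) (S : ({j // st j} → ℝ) → ℕ →ᵇ E) : Prop where
  rate_pos : 0 < μ
  rate_lt_one : μ < 1
  radius_pos : 0 < ε
  map_zero : S 0 = 0
  contDiffOn : ContDiffOn ℝ 1 S (Metric.ball 0 ε)
  isLayerIncrement : ∀ ξ ∈ Metric.ball (0 : {j // st j} → ℝ) ε,
    IsLayerIncrement a f uB fun n => μ ^ n • S ξ n
  stableCoords_eq : ∀ ξ ∈ Metric.ball (0 : {j // st j} → ℝ) ε, stableCoords b st (S ξ 0) = ξ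
  repr_fderiv : ∀ ξ j, ¬ st j → b.repr (fderiv ℝ S 0 ξ 0) j = 0

variable {f : E → E} {uB : E} {a μ : ℝ} {b : Module.Basis ι ℝ E} {lam : ι → ℝ} {st : ι → Prop}
  [DecidablePred st]

theorem exists_isLayerFamily (hf : ContDiff ℝ 3 f) (hc : HasCompactSupport f)
    (hA : ∀ j, fderiv ℝ f uB (b j) = lam j • b j) (hg : LayerGap a μ lam st) (hμ : μ < 1) :
    ∃ ε S, IsLayerFamily a f uB b st μ ε S := by
  obtain ⟨K, hK⟩ := hf.lipschitzWith_of_hasCompactSupport hc (by simp)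
  obtain ⟨-, S, hS0, hS1, hS2, hS3⟩ := exists_layer_profiles hf hc hK hA hg
  have h1 : ∀ᶠ ξ in 𝓝 0, ContDiffAt ℝ 1 S ξ := hS1.eventually (by simp)
  obtain ⟨ε, hε, hball⟩ := Metric.eventually_nhds_iff_ball.1 (h1.and hS2)
  exact ⟨ε, S, hg.pos, hμ, hε, hS0, fun ξ hξ => (hball ξ hξ).1.contDiffWithinAt,
    fun ξ hξ => (layerOp_eq_zero_iff_isLayerIncrement ..).1 (hball ξ hξ).2.1,
    fun ξ hξ => (hball ξ hξ).2.2, hS3⟩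

theorem exists_layerIncrement_unique (hf : ContDiff ℝ 3 f) (hc : HasCompactSupport f)
    (hA : ∀ j, fderiv ℝ f uB (b j) = lam j • b j) (hg : LayerGap a 1 lam st) :
    ∃ δ > 0, ∀ h h' : ℕ → E, (∀ n, ‖h n‖ < δ) → (∀ n, ‖h' n‖ < δ) → IsLayerIncrement a f uB h →
      IsLayerIncrement a f uB h' → stableCoords b st (h 0) = stableCoords b st (h' 0) →
      h = h' := by
  obtain ⟨K, hK⟩ := hf.lipschitzWith_of_hasCompactSupport hc (by simp)
  obtain ⟨⟨δ, hδ, H⟩, -⟩ := exists_layer_profiles hf hc hK hA hg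
  -- Strict pointwise bounds give only a weak bound on the supremum, hence the half.
  refine ⟨δ / 2, half_pos hδ, fun h h' hh hh' h1 h2 h3 => ?_⟩
  let κ : ℕ →ᵇ E := ofNormedAddCommGroupDiscrete h (δ / 2) fun n => (hh n).le
  let κ' : ℕ →ᵇ E := ofNormedAddCommGroupDiscrete h' (δ / 2) fun n => (hh' n).le
  have e : κ = κ' := H κ κ'
    (((BoundedContinuousFunction.norm_le (half_pos hδ).le).2 fun n => (hh n).le).trans_lt
      (half_lt_self hδ))
    (((BoundedContinuousFunction.norm_le (half_pos hδ).le).2 fun n => (hh' n).le).trans_lt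
      (half_lt_self hδ))
    ((layerOp_eq_zero_iff_isLayerIncrement ..).2 (by simpa [κ] using h1))
    ((layerOp_eq_zero_iff_isLayerIncrement ..).2 (by simpa [κ'] using h2)) h3
  exact congrArg DFunLike.coe e

end LayerEquation

/-! ### The defining function of the layer manifold -/

section Graph

variable {E : Type*} [NormedAddCommGroup E] [NormedSpace ℝ E] [FiniteDimensional ℝ E]
  {ι : Type*} {q : ℕ} {st : ι → Prop}

/-- The coordinates in the basis `b` whose index does not satisfy `st`. -/
noncomputable def unstableCoords (b : Module.Basis ι ℝ E) (e : Fin q ≃ {j // ¬ st j}) :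
    E →L[ℝ] EuclideanSpace ℝ (Fin q) :=
  ((EuclideanSpace.equiv (Fin q) ℝ).symm : (Fin q → ℝ) →L[ℝ] EuclideanSpace ℝ (Fin q)).comp
    (ContinuousLinearMap.pi fun i => LinearMap.toContinuousLinearMap (b.coord (e i)))

@[simp] theorem unstableCoords_apply (b : Module.Basis ι ℝ E) (e : Fin q ≃ {j // ¬ st j}) (x : E)
    (i : Fin q) : unstableCoords b e x i = b.repr x (e i) := rfl

theorem unstableCoords_eq_zero_iff (b : Module.Basis ι ℝ E) (e : Fin q ≃ {j // ¬ st j}) (x : E) :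
    unstableCoords b e x = 0 ↔ ∀ j, ¬ st j → b.repr x j = 0 := by
  constructor
  · intro h j hj
    obtain ⟨i, hi⟩ := e.surjective ⟨j, hj⟩
    have := congrFun (congrArg (fun y : EuclideanSpace ℝ (Fin q) => (y : Fin q → ℝ)) h) i
    simpa [hi] using this
  · intro h
    ext i
    simpa using h _ (e i).2

theorem eq_of_coords_eq (b : Module.Basis ι ℝ E) (e : Fin q ≃ {j // ¬ st j}) {x y : E}
    (h1 : stableCoords b st x = stableCoords b st y)
    (h2 : unstableCoords b e (x - y) = 0) : x = y := by
  refine b.ext_elem fun j => ?_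
  by_cases hj : st j
  · exact congrFun h1 ⟨j, hj⟩
  · have := (unstableCoords_eq_zero_iff b e _).1 h2 j hj
    simpa [sub_eq_zero] using this

theorem exists_unstableCoords_eq [Fintype ι] (b : Module.Basis ι ℝ E) (e : Fin q ≃ {j // ¬ st j})
    (w : EuclideanSpace ℝ (Fin q)) :
    ∃ x, stableCoords b st x = 0 ∧ unstableCoords b e x = w := by
  classical
  refine ⟨∑ j, (if hj : st j then 0 else w (e.symm ⟨j, hj⟩)) • b j, ?_, ?_⟩
  · funext ⟨j, hj⟩
    rw [stableCoords_apply, b.repr_sum_self]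
    simp [hj]
  · ext i
    rw [unstableCoords_apply, b.repr_sum_self, dif_neg (e i).2]
    simp

variable [Fintype ι] [DecidablePred st]

/-- The function whose zeros are the limits of the layer profiles in the family `S`. -/
noncomputable def layerDefining (uB : E) (b : Module.Basis ι ℝ E) (e : Fin q ≃ {j // ¬ st j})
    (S : ({j // st j} → ℝ) → ℕ →ᵇ E) (z : E) : EuclideanSpace ℝ (Fin q) :=
  unstableCoords b e (S (stableCoords b st (uB - z)) 0 - (uB - z))

variable {uB : E} {b : Module.Basis ι ℝ E} {S : ({j // st j} → ℝ) → ℕ →ᵇ E}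

theorem hasFDerivAt_layerDefining (e : Fin q ≃ {j // ¬ st j}) {z : E}
    (hS : DifferentiableAt ℝ S (stableCoords b st (uB - z))) :
    HasFDerivAt (layerDefining uB b e S)
      ((unstableCoords b e).comp (ContinuousLinearMap.id ℝ E - (evalCLM ℝ 0).comp
        ((fderiv ℝ S (stableCoords b st (uB - z))).comp (stableCoords b st)))) z := by
  have h0 : HasFDerivAt (fun z : E => uB - z) (-ContinuousLinearMap.id ℝ E) z :=
    (hasFDerivAt_id z).const_sub uB
  have h1 := (stableCoords b st).hasFDerivAt.comp z h0
  have h2 := hS.hasFDerivAt.comp z h1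
  have h3 := (evalCLM ℝ 0 : (ℕ →ᵇ E) →L[ℝ] E).hasFDerivAt.comp z h2
  have h4 := (unstableCoords b e).hasFDerivAt.comp z (h3.sub h0)
  refine h4.congr_fderiv ?_
  ext1 x
  simp only [ContinuousLinearMap.comp_apply, _root_.sub_apply,
    _root_.neg_apply, ContinuousLinearMap.id_apply, map_neg]
  congr 1
  abel

theorem contDiffOn_layerDefining (e : Fin q ≃ {j // ¬ st j}) {ε : ℝ}
    (hS : ContDiffOn ℝ 1 S (Metric.ball 0 ε)) {O : Set E}
    (hO : ∀ z ∈ O, stableCoords b st (uB - z) ∈ Metric.ball 0 ε) :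
    ContDiffOn ℝ 1 (layerDefining uB b e S) O := by
  have h0 : ContDiff ℝ 1 fun z : E => uB - z := contDiff_const.sub contDiff_id
  have h1 : ContDiffOn ℝ 1 (fun z => S (stableCoords b st (uB - z))) O :=
    hS.comp ((stableCoords b st).contDiff.comp h0).contDiffOn hO
  exact (unstableCoords b e).contDiff.comp_contDiffOn
    (((evalCLM ℝ 0 : (ℕ →ᵇ E) →L[ℝ] E).contDiff.comp_contDiffOn h1).sub h0.contDiffOn)

/-- The contribution of `S` to the derivative factors through the stable coordinates, so vectors
without stable coordinates already cover the target. -/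
theorem surjective_fderiv_layerDefining (e : Fin q ≃ {j // ¬ st j}) {z : E}
    (hS : DifferentiableAt ℝ S (stableCoords b st (uB - z))) :
    Function.Surjective (fderiv ℝ (layerDefining uB b e S) z) := by
  intro w
  obtain ⟨x, hx, hw⟩ := exists_unstableCoords_eq b e w
  refine ⟨x, ?_⟩
  rw [(hasFDerivAt_layerDefining e hS).fderiv]
  simp [hx, hw]

end Graph

/-! ### Reduction to a compactly supported flux and to eigenvector coordinates -/

theorem ContDiffOn.exists_hasCompactSupport_eventuallyEq {E F : Type*} [NormedAddCommGroup E]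
    [InnerProductSpace ℝ E] [FiniteDimensional ℝ E] [NormedAddCommGroup F] [NormedSpace ℝ F]
    {f : E → F} {U : Set E} {n : ℕ∞} (hf : ContDiffOn ℝ n f U) (hU : IsOpen U) {x : E}
    (hx : x ∈ U) :
    ∃ g : E → F, ContDiff ℝ n g ∧ HasCompactSupport g ∧ g =ᶠ[𝓝 x] f := by
  obtain ⟨R, hR, hball⟩ := Metric.nhds_basis_closedBall.mem_iff.1 (hU.mem_nhds hx)
  let χ : ContDiffBump x := ⟨R / 2, R, half_pos hR, half_lt_self hR⟩
  refine ⟨fun y => χ y • f y, ?_, χ.hasCompactSupport.smul_right, ?_⟩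
  · rw [contDiff_iff_contDiffAt]
    intro y
    by_cases hy : y ∈ U
    · exact χ.contDiff.contDiffAt.smul (hf.contDiffAt (hU.mem_nhds hy))
    · have hy' : y ∉ tsupport χ := by
        rw [χ.tsupport_eq]
        exact fun h => hy (hball h)
      refine (contDiffAt_const (c := (0 : F))).congr_of_eventuallyEq ?_
      filter_upwards [(isClosed_tsupport χ).isOpen_compl.mem_nhds hy'] with w hw
      simp [image_eq_zero_of_notMem_tsupport hw]
  · filter_upwards [χ.eventuallyEq_one] with y hy
    simp [hy]

theorem exists_layerGap {ι : Type*} [Finite ι] {a : ℝ} {lam : ι → ℝ} {st : ι → Prop}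
    (ha : 0 < a) (hcfl : ∀ j, a * |lam j| < 1) (hst : ∀ j, st j → lam j < 0)
    (hun : ∀ j, ¬ st j → 0 ≤ lam j) :
    ∃ μ < 1, LayerGap a μ lam st := by
  have hnum : ∀ j, 0 < 1 + a * lam j := fun j => by
    have := mul_le_mul_of_nonneg_left (neg_abs_le (lam j)) ha.le
    linarith [hcfl j]
  have hden : ∀ j, 0 < 1 - a * lam j := fun j => by
    have := mul_le_mul_of_nonneg_left (le_abs_self (lam j)) ha.le
    linarith [hcfl j]
  have hev : ∀ᶠ μ in 𝓝[<] (1 : ℝ), ∀ j, st j → 1 + a * lam j < μ * (1 - a * lam j) := by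
    refine eventually_all.2 fun j => ?_
    by_cases hj : st j
    · have hc : Tendsto (fun μ : ℝ => μ * (1 - a * lam j)) (𝓝[<] 1) (𝓝 (1 * (1 - a * lam j))) :=
        (Continuous.tendsto (by fun_prop) 1).mono_left nhdsWithin_le_nhds
      have := mul_neg_of_pos_of_neg ha (hst j hj)
      filter_upwards [hc.eventually_const_lt (show 1 + a * lam j < 1 * (1 - a * lam j) by linarith)]
        with μ hμ _ using hμ
    · exact Eventually.of_forall fun _ h => absurd h hj
  have hpos : ∀ᶠ μ in 𝓝[<] (1 : ℝ), 0 < μ :=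
    nhdsWithin_le_nhds (lt_mem_nhds one_pos)
  obtain ⟨μ, h1, h2, h3⟩ := (hev.and (hpos.and self_mem_nhdsWithin)).exists
  refine ⟨μ, h3, h2, h3.le, hnum, hden, h1, fun j hj => ?_⟩
  -- For speed zero the strict inequality comes entirely from `μ < 1`.
  have h4 := mul_nonneg ha.le (hun j hj)
  have h5 : μ * (1 - a * lam j) < 1 * (1 - a * lam j) :=
    mul_lt_mul_of_pos_right h3 (hden j)
  linarith

theorem layerGap_one {ι : Type*} {a μ : ℝ} {lam : ι → ℝ} {st : ι → Prop}
    (ha : 0 < a) (hg : LayerGap a μ lam st) (hst : ∀ j, st j → lam j < 0)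
    (hun : ∀ j, ¬ st j → 0 < lam j) : LayerGap a 1 lam st where
  pos := one_pos
  le_one := le_rfl
  num_pos := hg.num_pos
  den_pos := hg.den_pos
  stable j hj := by linarith [mul_neg_of_pos_of_neg ha (hst j hj)]
  unstable j hj := by linarith [mul_pos ha (hun j hj)]

/-! ### The discrete layer set -/

section LayerSet

variable {N : ℕ} {f : EuclideanSpace ℝ (Fin N) → EuclideanSpace ℝ (Fin N)}
  {uB : EuclideanSpace ℝ (Fin N)} {V : Set (EuclideanSpace ℝ (Fin N))} {l Q : ℝ}

theorem laxFriedrichsFlux_eq_iff (hl : l ≠ 0) (hQ : Q ≠ 0) (v w z : EuclideanSpace ℝ (Fin N)) :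
    laxFriedrichsFlux l Q f v w = f z ↔
      w - v = (l / (2 * Q)) • ((f w - f z) + (f v - f z)) := by
  have e : laxFriedrichsFlux l Q f v w - f z =
      (Q / l) • ((l / (2 * Q)) • ((f w - f z) + (f v - f z)) - (w - v)) := by
    have : Q / l * (l / (2 * Q)) = 1 / 2 := by field_simp
    rw [smul_sub, smul_smul, this, laxFriedrichsFlux]
    module
  rw [← sub_eq_zero, e, smul_eq_zero, or_iff_right (div_ne_zero hQ hl), sub_eq_zero, eq_comm]

theorem mem_discreteLayerSet_iff (hl : l ≠ 0) (hQ : Q ≠ 0) (z : EuclideanSpace ℝ (Fin N)) :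
    z ∈ discreteLayerSet (laxFriedrichsFlux l Q f) f V uB ↔
      z ∈ V ∧ ∃ h : ℕ → EuclideanSpace ℝ (Fin N), h 0 = uB - z ∧
        IsLayerIncrement (l / (2 * Q)) f uB h ∧ (∀ n, z + h n ∈ V) ∧
        Tendsto h atTop (𝓝 0) := by
  refine and_congr_right fun _ => ?_
  simp only [laxFriedrichsFlux_eq_iff hl hQ]
  constructor
  · rintro ⟨v, hV, h0, heq, hlim⟩
    refine ⟨fun n => v n - z, by simp only [h0], fun n => ?_, by simpa using hV, ?_⟩
    · simpa [h0] using heq n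
    · simpa using hlim.sub_const z
  · rintro ⟨h, h0, heq, hV, hlim⟩
    refine ⟨fun n => z + h n, hV, by simp [h0], fun n => ?_, by simpa using hlim.const_add z⟩
    simpa [h0] using heq n

theorem discreteLayerSet_mono
    {g : EuclideanSpace ℝ (Fin N) → EuclideanSpace ℝ (Fin N) → EuclideanSpace ℝ (Fin N)}
    {W : Set (EuclideanSpace ℝ (Fin N))} (h : V ⊆ W) :
    discreteLayerSet g f V uB ⊆ discreteLayerSet g f W uB :=
  fun _ ⟨hz, v, hv, hr⟩ => ⟨h hz, v, fun n => h (hv n), hr⟩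

/-- Profiles and limits lie in `V`, so only the values of the flux there matter; this permits the
cutoff. -/
theorem discreteLayerSet_laxFriedrichsFlux_congr
    {f' : EuclideanSpace ℝ (Fin N) → EuclideanSpace ℝ (Fin N)} (h : Set.EqOn f f' V) :
    discreteLayerSet (laxFriedrichsFlux l Q f) f V uB =
      discreteLayerSet (laxFriedrichsFlux l Q f') f' V uB := by
  ext z
  refine and_congr_right fun hz => exists_congr fun v => and_congr_right fun hv => ?_
  simp only [laxFriedrichsFlux, h hz, h (hv _)]

theorem self_mem_discreteLayerSet (h : uB ∈ V) :
    uB ∈ discreteLayerSet (laxFriedrichsFlux l Q f) f V uB :=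
  ⟨h, fun _ => uB, fun _ => h, rfl, fun _ => by simp only [laxFriedrichsFlux]; module,
    tendsto_const_nhds⟩

theorem tangentVectors_subset_of_eventually {M M' : Set (EuclideanSpace ℝ (Fin N))}
    {x : EuclideanSpace ℝ (Fin N)} (h : ∀ᶠ y in 𝓝 x, y ∈ M → y ∈ M') :
    tangentVectors M x ⊆ tangentVectors M' x := by
  rintro w ⟨γ, h0, hM, hd⟩
  refine ⟨γ, h0, ?_, hd⟩
  have hc : Tendsto γ (𝓝 0) (𝓝 x) := h0 ▸ hd.continuousAt
  filter_upwards [hM, hc.eventually h] with t h1 h2 using h2 h1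

variable {ι : Type*} [Fintype ι] {q : ℕ} {st : ι → Prop} [DecidablePred st]
  {b : Module.Basis ι ℝ (EuclideanSpace ℝ (Fin N))} {μ ε : ℝ}
  {S : ({j // st j} → ℝ) → ℕ →ᵇ EuclideanSpace ℝ (Fin N)} {a : ℝ}

/-! ### Geometry of the limits of a decaying layer family -/

namespace IsLayerFamily

theorem differentiableAt (hS : IsLayerFamily a f uB b st μ ε S) {ξ : {j // st j} → ℝ}
    (hξ : ξ ∈ Metric.ball 0 ε) : DifferentiableAt ℝ S ξ :=
  (hS.contDiffOn.contDiffAt (Metric.isOpen_ball.mem_nhds hξ)).differentiableAt one_ne_zero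

theorem norm_smul_le (hS : IsLayerFamily a f uB b st μ ε S)
    (h : ℕ →ᵇ EuclideanSpace ℝ (Fin N)) (n : ℕ) : ‖μ ^ n • h n‖ ≤ ‖h‖ := by
  rw [norm_smul, norm_pow, Real.norm_of_nonneg hS.rate_pos.le]
  calc _ ≤ 1 * ‖h‖ := by
        gcongr
        · exact pow_le_one₀ hS.rate_pos.le hS.rate_lt_one.le
        · exact norm_coe_le_norm h n
    _ = ‖h‖ := one_mul _

theorem tendsto_smul (hS : IsLayerFamily a f uB b st μ ε S)
    (h : ℕ →ᵇ EuclideanSpace ℝ (Fin N)) : Tendsto (fun n => μ ^ n • h n) atTop (𝓝 0) := by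
  have h1 : Tendsto (fun n => μ ^ n * ‖h‖) atTop (𝓝 (0 * ‖h‖)) :=
    (tendsto_pow_atTop_nhds_zero_of_lt_one hS.rate_pos.le hS.rate_lt_one).mul_const _
  rw [zero_mul] at h1
  refine squeeze_zero_norm (fun n => ?_) h1
  rw [norm_smul, norm_pow, Real.norm_of_nonneg hS.rate_pos.le]
  have := hS.rate_pos.le
  gcongr
  exact norm_coe_le_norm h n

theorem apply_zero_eq (hS : IsLayerFamily a f uB b st μ ε S) (e : Fin q ≃ {j // ¬ st j})
    {z : EuclideanSpace ℝ (Fin N)} (hz : stableCoords b st (uB - z) ∈ Metric.ball 0 ε)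
    (h0 : layerDefining uB b e S z = 0) : S (stableCoords b st (uB - z)) 0 = uB - z :=
  eq_of_coords_eq b e (hS.stableCoords_eq _ hz) h0

theorem mem_discreteLayerSet (hl : l ≠ 0) (hQ : Q ≠ 0)
    (hS : IsLayerFamily (l / (2 * Q)) f uB b st μ ε S)
    (e : Fin q ≃ {j // ¬ st j}) {z : EuclideanSpace ℝ (Fin N)}
    (hz : stableCoords b st (uB - z) ∈ Metric.ball 0 ε) (h0 : layerDefining uB b e S z = 0)
    (hzV : z ∈ V) (hV : ∀ n, z + μ ^ n • S (stableCoords b st (uB - z)) n ∈ V) :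
    z ∈ discreteLayerSet (laxFriedrichsFlux l Q f) f V uB :=
  (mem_discreteLayerSet_iff hl hQ z).2 ⟨hzV, _, by simpa using hS.apply_zero_eq e hz h0,
    hS.isLayerIncrement _ hz, hV, hS.tendsto_smul _⟩

theorem layerDefining_self (hS : IsLayerFamily a f uB b st μ ε S) (e : Fin q ≃ {j // ¬ st j}) :
    layerDefining uB b e S uB = 0 := by
  simp [layerDefining, hS.map_zero]

theorem fderiv_layerDefining_self (hS : IsLayerFamily a f uB b st μ ε S)
    (e : Fin q ≃ {j // ¬ st j}) :
    HasFDerivAt (layerDefining uB b e S) (unstableCoords b e) uB := by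
  have h0 : stableCoords b st (uB - uB) = 0 := by simp
  have := hasFDerivAt_layerDefining (uB := uB) (b := b) (S := S) e (z := uB)
    (by rw [h0]; exact hS.differentiableAt (Metric.mem_ball_self hS.radius_pos))
  refine this.congr_fderiv ?_
  ext1 x
  have hx := (unstableCoords_eq_zero_iff b e _).2
    (hS.repr_fderiv (stableCoords b st x))
  simp only [ContinuousLinearMap.comp_apply, _root_.sub_apply, ContinuousLinearMap.id_apply,
    map_sub, h0]
  simp [hx]

theorem tangentVectors_layerDefining (hS : IsLayerFamily a f uB b st μ ε S)
    (e : Fin q ≃ {j // ¬ st j}) :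
    tangentVectors {z | layerDefining uB b e S z = 0} uB =
      {w | ∀ j, ¬ st j → b.repr w j = 0} := by
  ext w
  constructor
  · rintro ⟨γ, h0, hM, hd⟩
    have hΨ : HasFDerivAt (layerDefining uB b e S) (unstableCoords b e) (γ 0) :=
      h0 ▸ hS.fderiv_layerDefining_self e
    have h1 := hΨ.comp_hasDerivAt 0 hd
    have h2 : HasDerivAt (layerDefining uB b e S ∘ γ) 0 0 :=
      (hasDerivAt_const (0 : ℝ) (0 : EuclideanSpace ℝ (Fin q))).congr_of_eventuallyEq hM
    exact (unstableCoords_eq_zero_iff b e w).1 (h1.unique h2)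
  · intro hw
    have hcoord : Tendsto (fun t : ℝ => -(t • stableCoords b st w)) (𝓝 0) (𝓝 0) := by
      have : Continuous fun t : ℝ => -(t • stableCoords b st w) := by fun_prop
      simpa using this.tendsto 0
    have hin : ∀ᶠ t : ℝ in 𝓝 0, -(t • stableCoords b st w) ∈ Metric.ball 0 ε :=
      hcoord.eventually (Metric.ball_mem_nhds 0 hS.radius_pos)
    -- The signs compensate: `S` describes `uB - z` rather than `z`.
    refine ⟨fun t => uB - S (-(t • stableCoords b st w)) 0, by simp [hS.map_zero], ?_, ?_⟩
    · filter_upwards [hin] with t ht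
      simp [layerDefining, hS.stableCoords_eq _ ht]
    · have h1 : HasDerivAt (fun t : ℝ => -(t • stableCoords b st w)) (-stableCoords b st w) 0 := by
        simpa using (hasDerivAt_id (0 : ℝ)).smul_const (-stableCoords b st w)
      have h2 : HasFDerivAt S (fderiv ℝ S 0) (-((0 : ℝ) • stableCoords b st w)) := by
        simpa using (hS.differentiableAt (Metric.mem_ball_self hS.radius_pos)).hasFDerivAt
      have h3 := ((evalCLM ℝ 0 : (ℕ →ᵇ EuclideanSpace ℝ (Fin N)) →L[ℝ] _).hasFDerivAt.comp_hasDerivAt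
        0 (h2.comp_hasDerivAt 0 h1)).const_sub uB
      refine h3.congr_deriv ?_
      have hcs : stableCoords b st (fderiv ℝ S 0 (stableCoords b st w) 0) =
          stableCoords b st w := by
        have k1 := ((stableCoords b st).comp (evalCLM ℝ 0)).hasFDerivAt.comp
          (0 : {j // st j} → ℝ)
          (hS.differentiableAt (Metric.mem_ball_self hS.radius_pos)).hasFDerivAt
        have k2 := (hasFDerivAt_id (𝕜 := ℝ) (0 : {j // st j} → ℝ)).congr_of_eventuallyEq
          (f₁ := ((stableCoords b st).comp (evalCLM ℝ 0)) ∘ S) (by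
            filter_upwards [Metric.ball_mem_nhds 0 hS.radius_pos] with ξ hξ
            exact hS.stableCoords_eq ξ hξ)
        exact congrArg (fun T => T (stableCoords b st w)) (k1.unique k2)
      have := eq_of_coords_eq b e hcs ((unstableCoords_eq_zero_iff b e _).2 fun j hj => by
        simp [hw j hj, hS.repr_fderiv _ j hj])
      simpa using this

/-- Near the boundary state, the coordinates of the initial increment are small enough for the
family `S` to give increments smaller than `δ`. -/
theorem eventually_small (hS : IsLayerFamily a f uB b st μ ε S) {δ : ℝ} (hδ : 0 < δ) :
    ∀ᶠ z in 𝓝 uB, stableCoords b st (uB - z) ∈ Metric.ball 0 ε ∧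
      ‖S (stableCoords b st (uB - z))‖ < δ := by
  have hP : Tendsto (fun z => stableCoords b st (uB - z)) (𝓝 uB) (𝓝 0) := by
    have : Continuous fun z => stableCoords b st (uB - z) := by fun_prop
    simpa using this.tendsto uB
  have hc : Tendsto (fun ξ => ‖S ξ‖) (𝓝 0) (𝓝 0) := by
    have := (hS.differentiableAt (Metric.mem_ball_self hS.radius_pos)).continuousAt.norm
    simpa [ContinuousAt, hS.map_zero] using this
  exact (hP.eventually (Metric.ball_mem_nhds 0 hS.radius_pos)).and
    (hP.eventually (hc.eventually_lt_const hδ))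

theorem isC1Submanifold {p : ℕ} (hpq : p + q = N) (hS : IsLayerFamily a f uB b st μ ε S)
    (e : Fin q ≃ {j // ¬ st j}) {M : Set (EuclideanSpace ℝ (Fin N))}
    (hM : ∀ x ∈ M, ∃ O, IsOpen O ∧ x ∈ O ∧
      (∀ z ∈ O, stableCoords b st (uB - z) ∈ Metric.ball 0 ε) ∧
      M ∩ O = {z ∈ O | layerDefining uB b e S z = 0}) : IsC1Submanifold p M := by
  intro x hx
  obtain ⟨O, hO, hxO, hball, hMO⟩ := hM x hx
  exact ⟨q, O, layerDefining uB b e S, hpq, hO, hxO,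
    contDiffOn_layerDefining e hS.contDiffOn hball,
    fun y hy => surjective_fderiv_layerDefining e (hS.differentiableAt (hball y hy)), hMO⟩

theorem exists_submanifold {p : ℕ} (hpq : p + q = N) (hl : l ≠ 0) (hQ : Q ≠ 0)
    (hS : IsLayerFamily (l / (2 * Q)) f uB b st μ ε S) (e : Fin q ≃ {j // ¬ st j})
    (hV : V ∈ 𝓝 uB) :
    ∃ M ⊆ discreteLayerSet (laxFriedrichsFlux l Q f) f V uB, uB ∈ M ∧ IsC1Submanifold p M := by
  obtain ⟨R, hR, hball⟩ := Metric.mem_nhds_iff.1 hV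
  -- Half of `R` is for the distance from `uB` to the limit, half for the increments.
  have hev := (hS.eventually_small (half_pos hR)).and (Metric.ball_mem_nhds uB (half_pos hR))
  obtain ⟨O, hOsub, hO, huO⟩ := mem_nhds_iff.1 hev
  refine ⟨{z ∈ O | layerDefining uB b e S z = 0}, ?_, ⟨huO, hS.layerDefining_self e⟩,
    hS.isC1Submanifold hpq e fun x hx => ⟨O, hO, hx.1, fun z hz => (hOsub hz).1.1, ?_⟩⟩
  · rintro z ⟨hz, h0⟩
    obtain ⟨⟨h1, h2⟩, h3⟩ := hOsub hz
    rw [dist_eq_norm] at h3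
    refine hS.mem_discreteLayerSet hl hQ e h1 h0 (hball ?_) fun n => hball ?_
    · rw [Metric.mem_ball, dist_eq_norm]; linarith
    · rw [Metric.mem_ball, dist_eq_norm, add_sub_right_comm]
      have := norm_add_le (z - uB) (μ ^ n • S (stableCoords b st (uB - z)) n)
      linarith [hS.norm_smul_le (S (stableCoords b st (uB - z))) n]
  · exact Set.inter_eq_left.2 fun z hz => hz.1

/-- `V` is an arbitrary open set, so the room around a profile comes from compactness of the profile
with its limit. Continuity of `S` in the supremum norm then moves all cells by less than this margin
at once. -/
theorem eventually_mem_discreteLayerSet (hl : l ≠ 0) (hQ : Q ≠ 0)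
    (hS : IsLayerFamily (l / (2 * Q)) f uB b st μ ε S) (e : Fin q ≃ {j // ¬ st j})
    (hV : IsOpen V) {x : EuclideanSpace ℝ (Fin N)} (hxV : x ∈ V)
    (hx : stableCoords b st (uB - x) ∈ Metric.ball 0 ε)
    (hprof : ∀ n, x + μ ^ n • S (stableCoords b st (uB - x)) n ∈ V) :
    ∀ᶠ z in 𝓝 x, stableCoords b st (uB - z) ∈ Metric.ball 0 ε ∧
      (layerDefining uB b e S z = 0 → z ∈ discreteLayerSet (laxFriedrichsFlux l Q f) f V uB) := by
  have hlim : Tendsto (fun n => x + μ ^ n • S (stableCoords b st (uB - x)) n) atTop (𝓝 x) := by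
    simpa using (hS.tendsto_smul (S (stableCoords b st (uB - x)))).const_add x
  obtain ⟨τ, hτ, hthick⟩ := hlim.isCompact_insert_range.exists_thickening_subset_open hV
    (Set.insert_subset hxV (Set.range_subset_iff.2 hprof))
  have hPc : Continuous fun z => stableCoords b st (uB - z) := by fun_prop
  have hSc : ContinuousAt (fun z => S (stableCoords b st (uB - z))) x :=
    ContinuousAt.comp (g := S) (hS.differentiableAt hx).continuousAt hPc.continuousAt
  filter_upwards [hPc.continuousAt.preimage_mem_nhds (Metric.isOpen_ball.mem_nhds hx),
    hV.mem_nhds hxV, Metric.ball_mem_nhds x (half_pos hτ),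
    hSc.preimage_mem_nhds (Metric.ball_mem_nhds _ (half_pos hτ))] with z h1 h2 h3 h4
  refine ⟨h1, fun h0 => hS.mem_discreteLayerSet hl hQ e h1 h0 h2 fun n => hthick ?_⟩
  refine Metric.mem_thickening_iff.2 ⟨_, Set.mem_insert_of_mem _ ⟨n, rfl⟩, ?_⟩
  rw [Set.mem_preimage, Metric.mem_ball, dist_eq_norm] at h4
  rw [Metric.mem_ball, dist_eq_norm] at h3
  rw [dist_eq_norm, add_sub_add_comm, ← smul_sub]
  have h5 := hS.norm_smul_le (S (stableCoords b st (uB - z)) - S (stableCoords b st (uB - x))) n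
  exact (norm_add_le _ _).trans_lt (by rw [coe_sub, Pi.sub_apply] at h5; linarith)

theorem exists_nhds_discreteLayerSet {p : ℕ} (hpq : p + q = N) (hl : l ≠ 0) (hQ : Q ≠ 0)
    (hS : IsLayerFamily (l / (2 * Q)) f uB b st μ ε S) (e : Fin q ≃ {j // ¬ st j})
    (huniq : ∃ δ > 0, ∀ h h' : ℕ → EuclideanSpace ℝ (Fin N), (∀ n, ‖h n‖ < δ) →
      (∀ n, ‖h' n‖ < δ) → IsLayerIncrement (l / (2 * Q)) f uB h →
      IsLayerIncrement (l / (2 * Q)) f uB h' →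
      stableCoords b st (h 0) = stableCoords b st (h' 0) → h = h') :
    ∃ V₀ ∈ 𝓝 uB, ∀ V ⊆ V₀, IsOpen V → uB ∈ V →
      IsC1Submanifold p (discreteLayerSet (laxFriedrichsFlux l Q f) f V uB) ∧
      tangentVectors (discreteLayerSet (laxFriedrichsFlux l Q f) f V uB) uB =
        {w | ∀ j, ¬ st j → b.repr w j = 0} := by
  obtain ⟨δ, hδ, H⟩ := huniq
  -- The radius `δ / 2` makes every profile value in `V` lie within `δ` of its limit, as the
  -- uniqueness statement requires.
  refine ⟨{z | (stableCoords b st (uB - z) ∈ Metric.ball 0 ε ∧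
      ‖S (stableCoords b st (uB - z))‖ < δ) ∧ z ∈ Metric.ball uB (δ / 2)},
    (hS.eventually_small hδ).and (Metric.ball_mem_nhds uB (half_pos hδ)), ?_⟩
  intro V hV hVo huV
  have key : ∀ z ∈ discreteLayerSet (laxFriedrichsFlux l Q f) f V uB,
      layerDefining uB b e S z = 0 ∧
        ∀ n, z + μ ^ n • S (stableCoords b st (uB - z)) n ∈ V := by
    intro z hz
    obtain ⟨hzV, h, h0, heq, hhV, -⟩ := (mem_discreteLayerSet_iff hl hQ z).1 hz
    obtain ⟨⟨h1, h2⟩, h3⟩ := hV hzV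
    have hh : ∀ n, ‖h n‖ < δ := fun n => by
      have h4 := (hV (hhV n)).2
      have h5 := dist_triangle_right (z + h n) z uB
      rw [Metric.mem_ball] at h3 h4
      rw [dist_eq_norm, add_sub_cancel_left] at h5
      linarith
    -- An arbitrary layer and the family member with the same stable coordinates are both small, so
    -- uniqueness identifies them.
    have hhS : h = fun n => μ ^ n • S (stableCoords b st (uB - z)) n := by
      refine H _ _ hh (fun n => (hS.norm_smul_le _ n).trans_lt h2) heq
        (hS.isLayerIncrement _ h1) ?_
      simp only [h0, pow_zero, one_smul, hS.stableCoords_eq _ h1]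
    have hh0 : S (stableCoords b st (uB - z)) 0 = uB - z := by
      have := congrFun hhS 0
      rwa [h0, pow_zero, one_smul, eq_comm] at this
    refine ⟨by simp only [layerDefining, hh0, sub_self, (unstableCoords b e).map_zero], fun n => ?_⟩
    have := hhV n
    rwa [hhS] at this
  have hloc : ∀ x ∈ discreteLayerSet (laxFriedrichsFlux l Q f) f V uB, ∀ᶠ z in 𝓝 x,
      stableCoords b st (uB - z) ∈ Metric.ball 0 ε ∧ (layerDefining uB b e S z = 0 →
        z ∈ discreteLayerSet (laxFriedrichsFlux l Q f) f V uB) := fun x hx =>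
    hS.eventually_mem_discreteLayerSet hl hQ e hVo hx.1 (hV hx.1).1.1 (key x hx).2
  refine ⟨hS.isC1Submanifold hpq e fun x hx => ?_, ?_⟩
  · obtain ⟨O, hOsub, hO, hxO⟩ := mem_nhds_iff.1 (hloc x hx)
    refine ⟨O, hO, hxO, fun z hz => (hOsub hz).1, ?_⟩
    ext z
    exact ⟨fun hz => ⟨hz.2, (key z hz.1).1⟩, fun hz => ⟨(hOsub hz.1).2 hz.2, hz.1⟩⟩
  · rw [← hS.tangentVectors_layerDefining e]
    refine Set.Subset.antisymm
      (tangentVectors_subset_of_eventually (Eventually.of_forall fun z hz => (key z hz).1))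
      (tangentVectors_subset_of_eventually ?_)
    filter_upwards [hloc uB (self_mem_discreteLayerSet huV)] with z hz using hz.2

end IsLayerFamily

end LayerSet

theorem Module.Basis.span_image_eq_setOf_repr_eq_zero {ι K M : Type*} [Fintype ι] [Ring K]
    [AddCommGroup M] [Module K M] (b : Module.Basis ι K M) (st : ι → Prop) :
    (Submodule.span K {w | ∃ j, st j ∧ w = b j} : Set M) = {w | ∀ j, ¬ st j → b.repr w j = 0} := by
  have : {w | ∃ j, st j ∧ w = b j} = b '' {j | st j} := by
    ext w; simp [eq_comm]
  ext w
  rw [this, SetLike.mem_coe, b.mem_span_image]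
  simp only [Set.subset_def, Finset.mem_coe, Finsupp.mem_support_iff, Set.mem_ofPred_eq]
  exact forall_congr' fun j => not_imp_comm

/-- Indices are zero-based: `lam j` is the `(j + 1)`-st wave speed. -/
theorem theorem3p9 {N : ℕ} (p : ℕ) (hp : p ≤ N)
    (U : Set (EuclideanSpace ℝ (Fin N))) (hU : IsOpen U)
    (f : EuclideanSpace ℝ (Fin N) → EuclideanSpace ℝ (Fin N)) (hf : ContDiffOn ℝ ∞ f U)
    (lam : Fin N → EuclideanSpace ℝ (Fin N) → ℝ)
    (r : Fin N → EuclideanSpace ℝ (Fin N) → EuclideanSpace ℝ (Fin N))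
    (hyp : StrictlyHyperbolicOn f U lam r)
    (uB : EuclideanSpace ℝ (Fin N)) (huB : uB ∈ U)
    (l Q : ℝ) (hl : 0 < l) (hQ0 : 0 < Q) (hQ1 : Q < 1)
    (hCFL : ∀ j, l * |lam j uB| < 2 * Q)
    (hsign : ∀ᶠ u in 𝓝 uB, ∀ j : Fin N,
      ((j : ℕ) < p → lam j u < 0) ∧ (p ≤ (j : ℕ) → 0 ≤ lam j u)) :
    uB ∈ discreteLayerSet (laxFriedrichsFlux l Q f) f U uB ∧
    (∀ V : Set (EuclideanSpace ℝ (Fin N)), IsOpen V → uB ∈ V → V ⊆ U →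
      ∃ M : Set (EuclideanSpace ℝ (Fin N)),
        M ⊆ discreteLayerSet (laxFriedrichsFlux l Q f) f V uB ∧ uB ∈ M ∧
          IsC1Submanifold p M) ∧
    ((∀ j : Fin N, p ≤ (j : ℕ) → 0 < lam j uB) →
      ∃ V₀ : Set (EuclideanSpace ℝ (Fin N)), IsOpen V₀ ∧ uB ∈ V₀ ∧ V₀ ⊆ U ∧
        ∀ V : Set (EuclideanSpace ℝ (Fin N)), IsOpen V → uB ∈ V → V ⊆ V₀ →
          IsC1Submanifold p (discreteLayerSet (laxFriedrichsFlux l Q f) f V uB) ∧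
          tangentVectors (discreteLayerSet (laxFriedrichsFlux l Q f) f V uB) uB =
            (Submodule.span ℝ {w | ∃ j : Fin N, (j : ℕ) < p ∧ w = r j uB} :
              Set (EuclideanSpace ℝ (Fin N)))) := by
  have ha : 0 < l / (2 * Q) := by positivity
  have hcfl : ∀ j, l / (2 * Q) * |lam j uB| < 1 := fun j => by
    rw [div_mul_eq_mul_div, div_lt_one (by positivity)]
    exact hCFL j
  obtain ⟨f₁, hf₁, hc₁, heq⟩ := hf.exists_hasCompactSupport_eventuallyEq hU huB
  have hind : LinearIndependent ℝ fun j => r j uB :=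
    Module.End.eigenvectors_linearIndependent' (fderiv ℝ f uB : Module.End ℝ _)
      (fun j => lam j uB) (hyp.strictMono uB huB).injective _ fun j =>
      ⟨Module.End.mem_eigenspace_iff.2 (hyp.eigenvector uB huB j),
        hyp.eigenvector_ne_zero uB huB j⟩
  let b := Module.Basis.mk hind (hind.span_eq_top_of_card_eq_finrank' (by simp)).ge
  have hb : ∀ j, b j = r j uB := fun j => by simp [b]
  have hA : ∀ j, fderiv ℝ f₁ uB (b j) = lam j uB • b j := fun j => by
    rw [heq.fderiv_eq, hb]
    exact hyp.eigenvector uB huB j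
  have hst : ∀ j : Fin N, (j : ℕ) < p → lam j uB < 0 := fun j => (hsign.self_of_nhds j).1
  have hun : ∀ j : Fin N, ¬ (j : ℕ) < p → 0 ≤ lam j uB := fun j hj =>
    (hsign.self_of_nhds j).2 (not_lt.1 hj)
  obtain ⟨μ, hμ, hg⟩ := exists_layerGap ha hcfl hst hun
  have hf₃ : ContDiff ℝ 3 f₁ := contDiff_infty.1 hf₁ 3
  obtain ⟨ε, S, hS⟩ := exists_isLayerFamily hf₃ hc₁ hA hg hμ
  have hpq : p + (N - p) = N := Nat.add_sub_cancel' hp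
  have e : Fin (N - p) ≃ {j : Fin N // ¬ (j : ℕ) < p} := (Fintype.equivFinOfCardEq (by
    rw [Fintype.card_subtype_compl, Fintype.card_fin, Fintype.card_subtype]
    congr 1
    exact Fin.card_filter_val_lt.trans (min_eq_right hp))).symm
  refine ⟨self_mem_discreteLayerSet huB, fun V hV huV _ => ?_, fun hpos => ?_⟩
  -- Shrinking `V` to where `f₁ = f` keeps a neighborhood of `uB`, on which the layer sets of both
  -- fluxes agree.
  · obtain ⟨M, hM, hMu, hMp⟩ := hS.exists_submanifold hpq hl.ne' hQ0.ne' e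
      (inter_mem (hV.mem_nhds huV) heq)
    refine ⟨M, hM.trans ?_, hMu, hMp⟩
    rw [discreteLayerSet_laxFriedrichsFlux_congr fun z hz => hz.2]
    exact discreteLayerSet_mono Set.inter_subset_left
  · have hg1 := layerGap_one ha hg hst fun j hj => hpos j (not_lt.1 hj)
    obtain ⟨V₁, hV₁, H⟩ := hS.exists_nhds_discreteLayerSet hpq hl.ne' hQ0.ne' e
      (exists_layerIncrement_unique hf₃ hc₁ hA hg1)
    obtain ⟨V₀, hsub, hV₀, huV₀⟩ := mem_nhds_iff.1
      (inter_mem (inter_mem hV₁ heq) (hU.mem_nhds huB))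
    refine ⟨V₀, hV₀, huV₀, fun z hz => (hsub hz).2, fun V hV huV hVV => ?_⟩
    have hspan := b.span_image_eq_setOf_repr_eq_zero fun j : Fin N => (j : ℕ) < p
    simp only [hb] at hspan
    rw [hspan, ← discreteLayerSet_laxFriedrichsFlux_congr fun z hz => (hsub (hVV hz)).1.2]
    exact H V (fun z hz => (hsub (hVV hz)).1.1) hV huV
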